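/- Let $G$ be an abelian Polish group that is quasi-torsion, i.e. topologically isomorphic to a closed subgroup of a product $\prod_{n\in\mathbb{N}} D_n$ (with the product topology) of countable discrete torsion groups $D_n$ such that every projection $G\to D_n$ is surjective. For a prime $p$, the $p$-Sylow subgroup of $G$ is the group of all $g\in G$ such that the closure of the cyclic subgroup $\langle g\rangle$ is a pro-$p$ group, that is, an inverse limit of finite $p$-groups. Suppose that $G$ is not locally compact, but that for every prime $p$ the $p$-Sylow subgroup of $G$ is locally compact. Then there exist closed non-compact subgroups $K_n\leq G$, $n\in\mathbb{N}$, such that the inclusions $K_n\hookrightarrow G$ extend to a topological group isomorphism of the full direct product $\prod_{n\in\mathbb{N}} K_n$ (with the product topology) onto a closed subgroup of $G$. -/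

import Mathlib

open Topology

/-- A topological group `G` is *quasi-`𝒟`*, for a class `𝒟` of groups, if it is (topologically
isomorphic to) a closed subgroup of a product `∏ₙ Dₙ` of countable discrete groups `Dₙ` from `𝒟`,
with the product topology, such that all the projections `G → Dₙ` are surjective.
(The groups `Dₙ` are countable, so nothing is lost by taking them in `Type`.) -/
def IsQuasi (𝒟 : (D : Type) → [Group D] → Prop) (G : Type*) [Group G] [TopologicalSpace G] :
    Prop :=
  ∃ (D : ℕ → Type) (_ : ∀ n, Group (D n)) (_ : ∀ n, TopologicalSpace (D n))
    (φ : G →* ∀ n, D n),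
    (∀ n, DiscreteTopology (D n) ∧ Countable (D n) ∧ 𝒟 (D n)) ∧
    IsClosedEmbedding φ ∧
    ∀ n, Function.Surjective fun g => φ g n

/-- Quasi-torsion groups: closed subdirect products of sequences of countable discrete torsion
groups. -/
def IsQuasiTorsion (G : Type*) [Group G] [TopologicalSpace G] : Prop :=
  IsQuasi (fun D _ => IsMulTorsion D) G

/-- A (Polish) topological group `G` is *pro-`𝒟`*, for a class `𝒟` of groups, if it is the inverse
limit of an inverse system `(Dᵢ, fᵢⱼ)` of countable discrete groups `Dᵢ` from `𝒟`, indexed by a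
non-empty directed preorder. The maps `πᵢ : G → Dᵢ` exhibit `G` as the inverse limit: `x ↦ (πᵢ x)ᵢ`
is a homeomorphism of `G` onto the group of compatible threads in `∏ᵢ Dᵢ`.
(A Polish group that is such a limit is the limit of a sequence of such groups, so nothing is lost
by taking the index set in `Type`.) -/
def IsPro (𝒟 : (D : Type) → [Group D] → Prop) (G : Type*) [Group G] [TopologicalSpace G] :
    Prop :=
  ∃ (ι : Type) (_ : Preorder ι) (_ : Nonempty ι) (_ : IsDirectedOrder ι)
    (D : ι → Type) (_ : ∀ i, Group (D i)) (_ : ∀ i, TopologicalSpace (D i))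
    (f : ∀ i j, i ≤ j → (D j →* D i)) (π : ∀ i, G →* D i),
    (∀ i, DiscreteTopology (D i) ∧ Countable (D i) ∧ 𝒟 (D i)) ∧
    (∀ i (x : D i), f i i le_rfl x = x) ∧
    (∀ i j k (hij : i ≤ j) (hjk : j ≤ k) (x : D k),
      f i j hij (f j k hjk x) = f i k (hij.trans hjk) x) ∧
    IsEmbedding (fun (x : G) (i : ι) => π i x) ∧
    Set.range (fun (x : G) (i : ι) => π i x) =
      {t : ∀ i, D i | ∀ i j (hij : i ≤ j), f i j hij (t j) = t i}

/-- Pro-`p` groups: inverse limits of finite discrete `p`-groups. -/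
def IsProP (p : ℕ) (G : Type*) [Group G] [TopologicalSpace G] : Prop :=
  IsPro (fun D _ => Finite D ∧ IsPGroup p D) G

/-- An element `g` is pro-`p` if the closed subgroup topologically generated by `g` is a pro-`p`
group. -/
def IsProPElement {G : Type*} [Group G] [TopologicalSpace G] [IsTopologicalGroup G]
    (p : ℕ) (g : G) : Prop :=
  IsProP p (Subgroup.zpowers g).topologicalClosure

/-- The (underlying set of the) `p`-Sylow subgroup of an abelian topological group: the set of all
its pro-`p` elements. -/
def proSylow (p : ℕ) (G : Type*) [CommGroup G] [TopologicalSpace G] [IsTopologicalGroup G] :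
    Set G :=
  {g | IsProPElement p g}

/-! Let U_n be the open subgroup of elements with trivial first n coordinates, and G_P the closed
subgroup of elements whose coordinates have only primes of P in their orders. Take K_n = U_n ∩
G_{P_n} for pairwise disjoint sets P_n of primes: the tails make infinite products converge, and
projecting coordinates to their P_n-parts recovers the factors
(`exists_isClosedEmbedding_of_disjoint`).

It remains to make K_n non-compact. No U_n is compact, as G is not locally compact. If U_n ∩ G_{p}
is non-compact for infinitely many p, use those p. Otherwise local compactness of the Sylow
subgroups gives a deeper U_m with every U_m ∩ G_{p} compact; some coordinate of U_m takes infinitely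
many values, so infinitely many primes occur there (`exists_infinite_primes`). Non-compactness
survives passing to infinite subsets of these primes, so they can be made disjoint. -/

/-! ### Primary parts of torsion abelian groups -/

/-- The subgroup of elements of a commutative group all of whose order's prime factors lie in `P`. -/
def piPart (P : Set ℕ) (D : Type*) [CommGroup D] : Subgroup D where
  carrier := {d | ∀ q : ℕ, q.Prime → q ∣ orderOf d → q ∈ P}
  one_mem' q hq h := absurd (by simpa using h) hq.ne_one
  mul_mem' {a b} ha hb q hq h :=
    ((hq.dvd_mul).1 (h.trans (Commute.all a b).orderOf_mul_dvd_mul_orderOf)).elim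
      (ha q hq) (hb q hq)
  inv_mem' {a} ha q hq h := ha q hq (by rwa [orderOf_inv] at h)

theorem mem_piPart {P : Set ℕ} {D : Type*} [CommGroup D] {d : D} :
    d ∈ piPart P D ↔ ∀ q : ℕ, q.Prime → q ∣ orderOf d → q ∈ P :=
  Iff.rfl

theorem mem_piPart_of_pow_eq_one {P : Set ℕ} {D : Type*} [CommGroup D] {d : D} {n : ℕ}
    (hn : ∀ q : ℕ, q.Prime → q ∣ n → q ∈ P) (h : d ^ n = 1) : d ∈ piPart P D :=
  fun q hq hd => hn q hq (hd.trans (orderOf_dvd_of_pow_eq_one h))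

theorem piPart_mono {P Q : Set ℕ} (h : P ⊆ Q) (D : Type*) [CommGroup D] :
    piPart P D ≤ piPart Q D :=
  fun _ hd q hq hq' => h (hd q hq hq')

theorem eq_one_of_mem_piPart {P Q : Set ℕ} (h : Disjoint P Q) {D : Type*} [CommGroup D] {d : D}
    (hP : d ∈ piPart P D) (hQ : d ∈ piPart Q D) : d = 1 := by
  rw [← orderOf_eq_one_iff, Nat.eq_one_iff_not_exists_prime_dvd]
  exact fun q hq hd => Set.disjoint_left.1 h (hP q hq hd) (hQ q hq hd)

theorem Nat.exists_eq_mul_primes_mem (P : Set ℕ) (L : ℕ) (hL : L ≠ 0) :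
    ∃ A B : ℕ, L = A * B ∧ (∀ q : ℕ, q.Prime → q ∣ A → q ∈ P) ∧
      ∀ q : ℕ, q.Prime → q ∣ B → q ∈ Pᶜ := by
  induction L using Nat.recOnMul with
  | zero => exact absurd rfl hL
  | one => exact ⟨1, 1, rfl, fun q hq h => absurd (Nat.dvd_one.1 h) hq.ne_one,
      fun q hq h => absurd (Nat.dvd_one.1 h) hq.ne_one⟩
  | prime p hp =>
    by_cases hpP : p ∈ P
    · exact ⟨p, 1, (mul_one p).symm,
        fun q hq h => by rwa [(Nat.prime_dvd_prime_iff_eq hq hp).1 h],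
        fun q hq h => absurd (Nat.dvd_one.1 h) hq.ne_one⟩
    · exact ⟨1, p, (one_mul p).symm, fun q hq h => absurd (Nat.dvd_one.1 h) hq.ne_one,
        fun q hq h => by rwa [(Nat.prime_dvd_prime_iff_eq hq hp).1 h]⟩
  | mul a b iha ihb =>
    obtain ⟨A, B, rfl, hA, hB⟩ := iha (left_ne_zero_of_mul hL)
    obtain ⟨A', B', rfl, hA', hB'⟩ := ihb (right_ne_zero_of_mul hL)
    exact ⟨A * A', B * B', by ring,
      fun q hq h => ((hq.dvd_mul).1 h).elim (hA q hq) (hA' q hq),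
      fun q hq h => ((hq.dvd_mul).1 h).elim (hB q hq) (hB' q hq)⟩

/-- Raising to a suitable power projects elements of exponent `L` onto the `P`-part. -/
theorem exists_pow_mem_piPart (P : Set ℕ) {L : ℕ} (hL : L ≠ 0) :
    ∃ c : ℕ, ∀ (D : Type*) [CommGroup D] (d : D), d ^ L = 1 →
      d ^ c ∈ piPart P D ∧ d / d ^ c ∈ piPart Pᶜ D := by
  obtain ⟨A, B, rfl, hA, hB⟩ := Nat.exists_eq_mul_primes_mem P L hL
  have hco : Nat.Coprime A B := Nat.coprime_of_dvd fun q hq h h' => hB q hq h' (hA q hq h)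
  -- The exponent is 1 modulo the `P`-part of `L` and 0 modulo the rest.
  obtain ⟨c, hcA, hcB⟩ := Nat.chineseRemainder hco 1 0
  refine ⟨c, fun D _ d hd => ⟨mem_piPart_of_pow_eq_one hA ?_, mem_piPart_of_pow_eq_one hB ?_⟩⟩
  · obtain ⟨k, rfl⟩ := (Nat.modEq_zero_iff_dvd).1 hcB
    rw [← pow_mul, show B * k * A = A * B * k by ring, pow_mul, hd, one_pow]
  · have h1 : (d ^ B) ^ A = 1 := by rw [← pow_mul, mul_comm, hd]
    have h2 : (d ^ B) ^ c = (d ^ B) ^ 1 :=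
      pow_eq_pow_iff_modEq.2 (hcA.of_dvd (orderOf_dvd_of_pow_eq_one h1))
    rw [div_pow, ← pow_mul, mul_comm c, pow_mul, h2, pow_one, div_self']

/-- The projection of a torsion group onto its `P`-part. -/
theorem exists_piPart_projection (P : Set ℕ) {D : Type*} [CommGroup D] (hD : IsMulTorsion D) :
    ∃ e : D →* D, ∀ d, e d ∈ piPart P D ∧ d / e d ∈ piPart Pᶜ D := by
  have hex (d : D) : ∃ a, a ∈ piPart P D ∧ d / a ∈ piPart Pᶜ D := by
    obtain ⟨c, hc⟩ := exists_pow_mem_piPart P (hD d).orderOf_pos.ne'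
    exact ⟨_, hc D d (pow_orderOf_eq_one d)⟩
  choose e he he' using hex
  refine ⟨MonoidHom.mk' e fun a b => ?_, fun d => ⟨he d, he' d⟩⟩
  refine div_eq_one.1 (eq_one_of_mem_piPart disjoint_compl_right
    (div_mem (he (a * b)) (mul_mem (he a) (he b))) ?_)
  have := div_mem (mul_mem (he' a) (he' b)) (he' (a * b))
  convert! this using 1
  rw [div_mul_div_comm, div_div_div_cancel_left]

/-- The projection of a torsion group onto its `P`-part. -/
noncomputable def piProj (P : Set ℕ) {D : Type*} [CommGroup D] (hD : IsMulTorsion D) : D →* D :=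
  (exists_piPart_projection P hD).choose

section piProj

variable {P : Set ℕ} {D : Type*} [CommGroup D] (hD : IsMulTorsion D)

theorem piProj_mem (d : D) : piProj P hD d ∈ piPart P D :=
  ((exists_piPart_projection P hD).choose_spec d).1

theorem div_piProj_mem (d : D) : d / piProj P hD d ∈ piPart Pᶜ D :=
  ((exists_piPart_projection P hD).choose_spec d).2

theorem piProj_eq_of_mem {d a : D} (ha : a ∈ piPart P D) (hd : d / a ∈ piPart Pᶜ D) :
    piProj P hD d = a := by
  refine div_eq_one.1 (eq_one_of_mem_piPart disjoint_compl_right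
    (div_mem (piProj_mem hD d) ha) ?_)
  have := div_mem hd (div_piProj_mem hD d)
  rwa [div_div_div_cancel_left] at this

theorem piProj_of_mem {d : D} (hd : d ∈ piPart P D) : piProj P hD d = d :=
  piProj_eq_of_mem hD hd (by rw [div_self']; exact one_mem _)

theorem piProj_of_mem_of_disjoint {Q : Set ℕ} (h : Disjoint P Q) {d : D} (hd : d ∈ piPart Q D) :
    piProj P hD d = 1 :=
  piProj_eq_of_mem hD (one_mem _)
    (by rw [div_one]; exact piPart_mono h.subset_compl_left D hd)

theorem eq_one_of_forall_piProj_eq_one {d : D}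
    (h : ∀ p : ℕ, p.Prime → piProj {p} hD d = 1) : d = 1 := by
  rw [← orderOf_eq_one_iff, Nat.eq_one_iff_not_exists_prime_dvd]
  intro p hp hpd
  have := div_piProj_mem (P := {p}) hD d
  rw [h p hp, div_one] at this
  exact this p hp hpd rfl

end piProj

/-- A sequence of infinite sets of natural numbers can be refined to a sequence of pairwise
disjoint infinite sets. -/
theorem exists_disjoint_infinite_subsets (B : ℕ → Set ℕ) (hB : ∀ n, (B n).Infinite) :
    ∃ P : ℕ → Set ℕ, (∀ n, P n ⊆ B n) ∧ (∀ n, (P n).Infinite) ∧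
      Pairwise fun m n => Disjoint (P m) (P n) := by
  choose f hf hlt using fun n m => (hB n).exists_gt m
  -- Step `t` picks a larger element of the set indexed by `t.unpair.1`, so each set is visited
  -- infinitely often.
  let g : ℕ → ℕ := fun t => Nat.rec 0 (fun t a => f t.unpair.1 a) t
  have hg (t : ℕ) : g (t + 1) = f t.unpair.1 (g t) := rfl
  have hmono : StrictMono g := strictMono_nat_of_lt_succ fun t => by rw [hg]; exact hlt _ _
  refine ⟨fun n => (fun k => g (Nat.pair n k + 1)) '' Set.univ, ?_, fun n => ?_, fun m n hmn => ?_⟩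
  · rintro n _ ⟨k, -, rfl⟩
    simp only [hg, Nat.unpair_pair]
    exact hf _ _
  · refine Set.infinite_univ.image fun a _ b _ hab => ?_
    exact (Nat.pair_eq_pair.1 (Nat.succ_injective (hmono.injective hab))).2
  · refine Set.disjoint_left.2 ?_
    rintro _ ⟨a, -, rfl⟩ ⟨b, -, hab⟩
    exact hmn (Nat.pair_eq_pair.1 (Nat.succ_injective (hmono.injective hab))).1.symm

/-! ### Compactness and primes in closed subgroups of the product -/

section ClosedSubdirect

variable {G : Type*} [CommGroup G] {D : ℕ → Type} [∀ n, CommGroup (D n)]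
  (φ : G →* ∀ n, D n)

/-- The subgroup of elements whose first `n` coordinates are trivial. -/
def tailSubgroup (n : ℕ) : Subgroup G :=
  (Subgroup.pi (Set.Iio n) fun i => (⊥ : Subgroup (D i))).comap φ

/-- The subgroup of elements all of whose coordinates lie in the `P`-part. -/
def piSubgroup (P : Set ℕ) : Subgroup G :=
  (Subgroup.pi Set.univ fun i => piPart P (D i)).comap φ

variable {φ}

theorem mem_tailSubgroup {n : ℕ} {g : G} : g ∈ tailSubgroup φ n ↔ ∀ i < n, φ g i = 1 :=
  Iff.rfl

theorem mem_piSubgroup {P : Set ℕ} {g : G} :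
    g ∈ piSubgroup φ P ↔ ∀ i, φ g i ∈ piPart P (D i) := by
  simp [piSubgroup, Subgroup.mem_pi]

theorem tailSubgroup_anti : Antitone (tailSubgroup φ) :=
  fun _ _ hmn _ hg i hi => hg i (hi.trans_le hmn)

theorem piSubgroup_mono : Monotone (piSubgroup φ) := fun _ _ h _ hg =>
  mem_piSubgroup.2 fun i => piPart_mono h _ (mem_piSubgroup.1 hg i)

variable [TopologicalSpace G] [∀ n, TopologicalSpace (D n)] (hφ : IsClosedEmbedding φ)
include hφ

theorem exists_eq_of_forall_approx {y : ∀ i, D i} (h : ∀ n, ∃ g, ∀ i < n, φ g i = y i) :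
    ∃ g, φ g = y := by
  choose g hg using h
  refine Set.mem_range.1 <| hφ.isClosed_range.mem_of_tendsto (f := fun n => φ (g n)) (b := Filter.atTop)
    (tendsto_pi_nhds.2 fun i => ?_) (Filter.Eventually.of_forall fun n => ⟨_, rfl⟩)
  refine tendsto_const_nhds.congr' ?_
  filter_upwards [Filter.eventually_gt_atTop i] with n hn using (hg n i hn).symm

theorem exists_tailSubgroup_subset {s : Set G} (hs : s ∈ 𝓝 1) :
    ∃ n, (tailSubgroup φ n : Set G) ⊆ s := by
  rw [hφ.isInducing.nhds_eq_comap, map_one, nhds_pi, Filter.mem_comap] at hs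
  obtain ⟨t, ht, hts⟩ := hs
  obtain ⟨I, hI, u, hu, hut⟩ := Filter.mem_pi.1 ht
  obtain ⟨b, hb⟩ := hI.bddAbove
  refine ⟨b + 1, fun g hg => hts (hut fun i hi => ?_)⟩
  rw [mem_tailSubgroup.1 hg i (Nat.lt_succ_of_le (hb hi))]
  exact mem_of_mem_nhds (hu i)

theorem isCompact_of_finite_coordinates {H : Set G} (hH : IsClosed H)
    (h : ∀ i, ((fun g => φ g i) '' H).Finite) : IsCompact H :=
  (hφ.isCompact_preimage (isCompact_univ_pi fun i => (h i).isCompact)).of_isClosed_subset hH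
    fun g hg _ _ => ⟨g, hg, rfl⟩

/-- On finitely many coordinates of `g` the projection is a power map; these powers of `g` converge
in the closed image. -/
theorem exists_apply_eq_piProj (hD : ∀ n, IsMulTorsion (D n)) (P : Set ℕ) (g : G) :
    ∃ a, φ a = fun i => piProj P (hD i) (φ g i) := by
  refine exists_eq_of_forall_approx hφ fun n => ?_
  have hL : (∏ i ∈ Finset.range n, orderOf (φ g i)) ≠ 0 :=
    Finset.prod_ne_zero_iff.2 fun i _ => (hD i _).orderOf_pos.ne'
  obtain ⟨c, hc⟩ := exists_pow_mem_piPart P hL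
  refine ⟨g ^ c, fun i hi => ?_⟩
  obtain ⟨h1, h2⟩ := hc (D i) (φ g i)
    (orderOf_dvd_iff_pow_eq_one.1 (Finset.dvd_prod_of_mem _ (Finset.mem_range.2 hi)))
  rw [map_pow, Pi.pow_apply, piProj_eq_of_mem (hD i) h1 h2]

variable [∀ n, DiscreteTopology (D n)]

theorem isClosed_tailSubgroup (n : ℕ) : IsClosed (tailSubgroup φ n : Set G) :=
  (isClosed_set_pi fun _ _ => isClosed_discrete _).preimage hφ.continuous

theorem isClosed_piSubgroup (P : Set ℕ) : IsClosed (piSubgroup φ P : Set G) :=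
  (isClosed_set_pi fun _ _ => isClosed_discrete _).preimage hφ.continuous

theorem tailSubgroup_mem_nhds (n : ℕ) : (tailSubgroup φ n : Set G) ∈ 𝓝 1 :=
  ((isOpen_set_pi (Set.finite_Iio n) fun _ _ => isOpen_discrete _).preimage
    hφ.continuous).mem_nhds (one_mem (tailSubgroup φ n))

theorem IsCompact.finite_coordinates {H : Set G} (hH : IsCompact H) (i : ℕ) :
    ((fun g => φ g i) '' H).Finite :=
  (hH.image ((continuous_apply i).comp hφ.continuous)).finite_of_discrete

theorem exists_infinite_primes_of_isCompact (hD : ∀ n, IsMulTorsion (D n)) {n : ℕ}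
    (hU : ¬ IsCompact (tailSubgroup φ n : Set G))
    (hc : ∀ p : ℕ, p.Prime → IsCompact ((tailSubgroup φ n ⊓ piSubgroup φ {p} : Subgroup G) : Set G)) :
    ∃ B : Set ℕ, B.Infinite ∧ ∀ P ⊆ B, P.Infinite →
      ¬ IsCompact ((tailSubgroup φ n ⊓ piSubgroup φ P : Subgroup G) : Set G) := by
  obtain ⟨i, hi⟩ : ∃ i, ((fun g => φ g i) '' (tailSubgroup φ n : Set G)).Infinite := by
    by_contra! h
    exact hU (isCompact_of_finite_coordinates hφ (isClosed_tailSubgroup hφ n)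
      h)
  have key (p : ℕ) {d : D i} (hd : d ∈ (fun g => φ g i) '' (tailSubgroup φ n : Set G)) :
      ∃ a ∈ tailSubgroup φ n ⊓ piSubgroup φ {p}, φ a i = piProj {p} (hD i) d := by
    obtain ⟨g, hg, rfl⟩ := hd
    obtain ⟨a, ha⟩ := exists_apply_eq_piProj hφ hD {p} g
    refine ⟨a, ⟨fun j hj => ?_, mem_piSubgroup.2 fun j => ?_⟩, by rw [ha]⟩
    · rw [ha]
      simp [mem_tailSubgroup.1 hg j hj]
    · rw [ha]
      exact piProj_mem _ _
  let B : Set ℕ := {p | p.Prime ∧ ∃ a ∈ tailSubgroup φ n ⊓ piSubgroup φ {p}, φ a i ≠ 1}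
  refine ⟨B, fun hB => hi ?_, fun P hP hPinf hcomp => ?_⟩
  · have := hB.to_subtype
    have hfin := Set.Finite.pi' (ι := B) (κ := fun _ => D i)
      fun p => (hc p p.2.1).finite_coordinates hφ i
    refine Set.Finite.of_finite_image
      (f := fun d (p : B) => piProj {(p : ℕ)} (hD i) d) (hfin.subset ?_) ?_
    · rintro _ ⟨d, hd, rfl⟩ p
      obtain ⟨a, ha, had⟩ := key p hd
      exact ⟨a, ha, had⟩
    -- Primes outside `B` see only trivial parts of `d / d'`, so the parts at `B` determine `d`.
    · intro d hd d' hd' hdd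
      refine div_eq_one.1 (eq_one_of_forall_piProj_eq_one (hD i) fun p hp => ?_)
      by_cases hpB : p ∈ B
      · rw [map_div, div_eq_one]
        exact congrFun hdd ⟨p, hpB⟩
      · by_contra hne
        obtain ⟨g, hg, rfl⟩ := hd
        obtain ⟨g', hg', rfl⟩ := hd'
        obtain ⟨a, ha, had⟩ := key p ⟨g / g', div_mem hg hg', rfl⟩
        refine hpB ⟨hp, a, ha, ?_⟩
        rw [had]
        simpa using hne
  -- Nontrivial elements from distinct primes differ at coordinate `i`, so an infinite `P` gives
  -- infinitely many values there.
  · have hex (p : P) : ∃ a ∈ tailSubgroup φ n ⊓ piSubgroup φ {(p : ℕ)}, φ a i ≠ 1 :=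
      (hP p.2).2
    choose a ha hane using hex
    have := hPinf.to_subtype
    refine Set.infinite_of_injective_forall_mem (f := fun p : P => φ (a p) i)
      (fun p q hpq => ?_) (fun p => ?_) (hcomp.finite_coordinates hφ i)
    · by_contra hne
      refine hane p (eq_one_of_mem_piPart (P := {(p : ℕ)}) (Q := {(q : ℕ)})
        (Set.disjoint_singleton.2 fun h => hne (Subtype.ext h)) (mem_piSubgroup.1 (ha p).2 i) ?_)
      simp only at hpq
      rw [hpq]
      exact mem_piSubgroup.1 (ha q).2 i
    · exact ⟨a p, ⟨(ha p).1, piSubgroup_mono (Set.singleton_subset_iff.2 p.2) (ha p).2⟩, rfl⟩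

theorem not_isCompact_inf_of_le {m n : ℕ} (hmn : m ≤ n) {P Q : Set ℕ} (hPQ : P ⊆ Q)
    (h : ¬ IsCompact ((tailSubgroup φ n ⊓ piSubgroup φ P : Subgroup G) : Set G)) :
    ¬ IsCompact ((tailSubgroup φ m ⊓ piSubgroup φ Q : Subgroup G) : Set G) := fun hc =>
  h (hc.of_isClosed_subset ((isClosed_tailSubgroup hφ n).inter (isClosed_piSubgroup hφ P))
    (inf_le_inf (tailSubgroup_anti hmn) (piSubgroup_mono hPQ)))

theorem exists_infinite_primes (hD : ∀ n, IsMulTorsion (D n))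
    (hU : ∀ n, ¬ IsCompact (tailSubgroup φ n : Set G))
    (hc : ∀ p : ℕ, p.Prime →
      ∃ n, IsCompact ((tailSubgroup φ n ⊓ piSubgroup φ {p} : Subgroup G) : Set G)) (n : ℕ) :
    ∃ B : Set ℕ, B.Infinite ∧ ∀ P ⊆ B, P.Infinite →
      ¬ IsCompact ((tailSubgroup φ n ⊓ piSubgroup φ P : Subgroup G) : Set G) := by
  let A : Set ℕ := {p | p.Prime ∧
    ¬ IsCompact ((tailSubgroup φ n ⊓ piSubgroup φ {p} : Subgroup G) : Set G)}
  by_cases hA : A.Infinite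
  · refine ⟨A, hA, fun P hP hPinf => ?_⟩
    obtain ⟨p, hp⟩ := hPinf.nonempty
    exact not_isCompact_inf_of_le hφ le_rfl (Set.singleton_subset_iff.2 hp) (hP hp).2
  · choose! N hN using hc
    -- Beyond `b`, the finitely many exceptional primes in `A` have compact parts too.
    obtain ⟨b, hb⟩ := ((Set.not_infinite.1 hA).image N).bddAbove
    obtain ⟨B, hB, hBP⟩ := exists_infinite_primes_of_isCompact hφ hD (hU (max n b))
      fun p hp => by
        by_contra h
        have hpA : p ∈ A := ⟨hp, not_isCompact_inf_of_le hφ (le_max_left n b) subset_rfl h⟩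
        exact not_isCompact_inf_of_le hφ ((hb ⟨p, hpA, rfl⟩).trans (le_max_right n b)) subset_rfl h
          (hN p hp)
    exact ⟨B, hB, fun P hP hPinf =>
      not_isCompact_inf_of_le hφ (le_max_left n b) subset_rfl (hBP P hP hPinf)⟩

end ClosedSubdirect

/-! ### Pro-p elements and local compactness -/

section ProP

variable {G : Type*} [CommGroup G] [TopologicalSpace G] [IsTopologicalGroup G]
  {D : ℕ → Type} [∀ n, CommGroup (D n)] [∀ n, TopologicalSpace (D n)]
  [∀ n, DiscreteTopology (D n)] {φ : G →* ∀ n, D n}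

/-- The restriction of a sequence to its first `n` coordinates. -/
def restrictFin (D : ℕ → Type) [∀ n, CommGroup (D n)] (n : ℕ) :
    (∀ i, D i) →* ∀ i : Fin n, D i where
  toFun x i := x i
  map_one' := rfl
  map_mul' _ _ := rfl

omit [∀ n, TopologicalSpace (D n)] [∀ n, DiscreteTopology (D n)] [TopologicalSpace G]
  [IsTopologicalGroup G] in
theorem exists_restrictFin_pow_eq_one (hD : ∀ n, IsMulTorsion (D n)) {p : ℕ} {g : G}
    (hg : g ∈ piSubgroup φ {p}) (n : ℕ) : ∃ k, restrictFin D n (φ g) ^ p ^ k = 1 := by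
  have h (i : ℕ) : ∃ k, φ g i ^ p ^ k = 1 := by
    refine ⟨_, orderOf_dvd_iff_pow_eq_one.1 (dvd_of_eq
      (Nat.eq_prime_pow_of_unique_prime_dvd (hD i _).orderOf_pos.ne' fun {q} hq hqd => ?_))⟩
    exact mem_piSubgroup.1 hg i q hq hqd
  choose k hk using h
  refine ⟨∑ i ∈ Finset.range n, k i, funext fun i => ?_⟩
  obtain ⟨c, hc⟩ := pow_dvd_pow p
    (Finset.single_le_sum (f := k) (fun _ _ => Nat.zero_le _) (Finset.mem_range.2 i.2))
  change φ g i ^ _ = 1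
  rw [hc, pow_mul, hk, one_pow]

/-- The closure of ⟨g⟩ is the inverse limit of the finite cyclic p-groups generated by the
restrictions of `g` to its first n coordinates. -/
theorem piSubgroup_singleton_subset_proSylow (hφ : IsClosedEmbedding φ)
    (hD : ∀ n, IsMulTorsion (D n)) {p : ℕ} (hp : p.Prime) :
    (piSubgroup φ {p} : Set G) ⊆ proSylow p G := by
  intro g hg
  let H := (Subgroup.zpowers g).topologicalClosure
  let Z (n : ℕ) := Subgroup.zpowers (restrictFin D n (φ g))
  have hρ (n : ℕ) : Continuous (restrictFin D n) :=
    continuous_pi fun i => continuous_apply (i : ℕ)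
  have hπ (n : ℕ) (x : H) : restrictFin D n (φ x) ∈ Z n := by
    refine closure_minimal (t := (fun x => restrictFin D n (φ x)) ⁻¹' (Z n : Set _)) ?_
      ((isClosed_discrete _).preimage ((hρ n).comp hφ.continuous)) x.2
    rintro _ ⟨k, rfl⟩
    exact ⟨k, by simp⟩
  let π (n : ℕ) : H →* Z n :=
    ((restrictFin D n).comp (φ.comp H.subtype)).codRestrict (Z n) (hπ n)
  have hf (i j : ℕ) (hij : i ≤ j) (x : Z j) :
      (fun a : Fin i => (x : ∀ i : Fin j, D i) (a.castLE hij)) ∈ Z i := by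
    obtain ⟨_, k, rfl⟩ := x
    exact ⟨k, rfl⟩
  let f (i j : ℕ) (hij : i ≤ j) : Z j →* Z i :=
    { toFun := fun x => ⟨_, hf i j hij x⟩
      map_one' := rfl
      map_mul' := fun _ _ => rfl }
  have hφH : IsClosedEmbedding (φ.comp H.subtype) :=
    hφ.comp (Subgroup.isClosed_topologicalClosure _).isClosedEmbedding_subtypeVal
  refine ⟨ℕ, inferInstance, inferInstance, inferInstance, fun n => Z n, fun n => inferInstance,
    fun n => inferInstance, f, π, fun n => ?_, fun i x => rfl, fun i j k hij hjk x => rfl, ?_, ?_⟩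
  · obtain ⟨k, hk⟩ := exists_restrictFin_pow_eq_one hD hg n
    have hfin : Finite (Z n) := finite_zpowers.2
      (isOfFinOrder_iff_pow_eq_one.2 ⟨_, pow_pos hp.pos k, hk⟩)
    refine ⟨inferInstance, inferInstance, hfin, ?_⟩
    rintro ⟨_, m, rfl⟩
    refine ⟨k, Subtype.ext ?_⟩
    change (_ ^ m) ^ p ^ k = 1
    rw [← zpow_natCast, zpow_comm, zpow_natCast, hk, one_zpow]
  -- Coordinate i of `φ` is the last entry of the thread at level i + 1.
  · refine IsEmbedding.of_comp (g := fun (t : ∀ n, Z n) i =>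
      (t (i + 1) : ∀ j : Fin (i + 1), D j) (Fin.last i)) ?_ ?_ hφH.isEmbedding
    · exact continuous_pi fun n => Continuous.subtype_mk ((hρ n).comp hφH.continuous) _
    · exact continuous_pi fun i => (continuous_apply (Fin.last i)).comp
        (continuous_subtype_val.comp (continuous_apply (i + 1)))
  · refine Set.Subset.antisymm ?_ fun t ht => ?_
    · rintro _ ⟨x, rfl⟩ i j hij
      rfl
    · have key (n i : ℕ) (hi : i < n) :
          (t n : ∀ j : Fin n, D j) ⟨i, hi⟩ = (t (i + 1) : ∀ j : Fin (i + 1), D j) (Fin.last i) := by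
        rw [← ht (i + 1) n hi]
        rfl
      obtain ⟨a, ha⟩ := exists_eq_of_forall_approx hφH
        (y := fun i => (t (i + 1) : ∀ j : Fin (i + 1), D j) (Fin.last i)) fun n => by
          obtain ⟨k, hk⟩ := (t n).2
          refine ⟨⟨g, subset_closure (Subgroup.mem_zpowers g)⟩ ^ k, fun i hi => ?_⟩
          rw [← key n i hi, ← hk]
          simp [restrictFin]
      refine ⟨a, funext fun n => Subtype.ext (funext fun i => ?_)⟩
      exact (congrFun ha i).trans (key n i i.2).symm

theorem exists_isCompact_inf_of_locallyCompact_proSylow (hφ : IsClosedEmbedding φ)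
    (hD : ∀ n, IsMulTorsion (D n)) {p : ℕ} (hp : p.Prime)
    (h : LocallyCompactSpace (proSylow p G)) :
    ∃ n, IsCompact ((tailSubgroup φ n ⊓ piSubgroup φ {p} : Subgroup G) : Set G) := by
  have hsub := piSubgroup_singleton_subset_proSylow hφ hD hp
  obtain ⟨C, hC, hC1⟩ := exists_compact_mem_nhds (⟨1, hsub (one_mem _)⟩ : proSylow p G)
  obtain ⟨V, hV, hVC⟩ := mem_nhds_induced _ _ _ |>.1 hC1
  obtain ⟨n, hn⟩ := exists_tailSubgroup_subset hφ hV
  refine ⟨n, (hC.image continuous_subtype_val).of_isClosed_subset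
    ((isClosed_tailSubgroup hφ n).inter (isClosed_piSubgroup hφ {p})) ?_⟩
  exact fun g hg => ⟨⟨g, hsub hg.2⟩, hVC (hn hg.1), rfl⟩

end ProP

/-! ### Assembling the direct product -/

section Product

variable {G : Type*} [CommGroup G] [TopologicalSpace G]
  {D : ℕ → Type} [∀ n, CommGroup (D n)] [∀ n, TopologicalSpace (D n)] {φ : G →* ∀ n, D n}

/-- The product of the members of a sequence whose `n`-th term has trivial first `n`
coordinates. -/
def tailProd (φ : G →* ∀ n, D n) (K : ℕ → Subgroup G) : (∀ n, K n) →* ∀ i, D i where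
  toFun x i := ∏ k ∈ Finset.range (i + 1), φ (x k) i
  map_one' := by ext; simp
  map_mul' x y := by ext; simp [Finset.prod_mul_distrib]

omit [TopologicalSpace G] [∀ n, TopologicalSpace (D n)] in
theorem tailProd_apply (K : ℕ → Subgroup G) (x : ∀ n, K n) (i : ℕ) :
    tailProd φ K x i = ∏ k ∈ Finset.range (i + 1), φ (x k) i :=
  rfl

/-- Factors with index above i are trivial at coordinate i, so finite partial products approximate
the infinite product, and the closed image contains it. -/
theorem exists_hom_of_tail (hφ : IsClosedEmbedding φ) {K : ℕ → Subgroup G}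
    (hK : ∀ n, K n ≤ tailSubgroup φ n) :
    ∃ ψ : (∀ n, K n) →* G, (∀ x, φ (ψ x) = tailProd φ K x) ∧
      ∀ n (k : K n), ψ (Pi.mulSingle n k) = k := by
  have hmem (x : ∀ n, K n) : tailProd φ K x ∈ φ.range := by
    refine exists_eq_of_forall_approx hφ fun n =>
      ⟨∏ k ∈ Finset.range n, (x k : G), fun i hi => ?_⟩
    rw [map_prod, Finset.prod_apply, tailProd_apply]
    refine (Finset.prod_subset (Finset.range_subset_range.2 hi) fun k _ hk => ?_).symm
    exact hK k (x k).2 i (by simpa using hk)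
  let ψ : (∀ n, K n) →* G := (MonoidHom.ofInjective hφ.injective).symm.toMonoidHom.comp
    ((tailProd φ K).codRestrict φ.range hmem)
  have hψ (x) : φ (ψ x) = tailProd φ K x :=
    MonoidHom.apply_ofInjective_symm hφ.injective ⟨_, hmem x⟩
  refine ⟨ψ, hψ, fun n k => hφ.injective ?_⟩
  rw [hψ]
  ext i
  rw [tailProd_apply]
  by_cases hi : n ≤ i
  · rw [Finset.prod_eq_single n]
    · simp
    · intro j _ hj
      simp [Pi.mulSingle_eq_of_ne hj]
    · intro h
      exact absurd (Finset.mem_range.2 (Nat.lt_succ_of_le hi)) h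
  · rw [hK n k.2 i (not_le.1 hi)]
    refine Finset.prod_eq_one fun j hj => ?_
    have : j ≠ n := by
      have := Finset.mem_range.1 hj
      omega
    simp [Pi.mulSingle_eq_of_ne this]

theorem exists_isClosedEmbedding_of_disjoint [∀ n, DiscreteTopology (D n)]
    (hφ : IsClosedEmbedding φ) (hD : ∀ n, IsMulTorsion (D n)) {P : ℕ → Set ℕ}
    (hP : Pairwise fun m n => Disjoint (P m) (P n)) {K : ℕ → Subgroup G}
    (hK : ∀ n, K n = tailSubgroup φ n ⊓ piSubgroup φ (P n)) :
    ∃ ψ : (∀ n, K n) →* G, IsClosedEmbedding ψ ∧ ∀ n (k : K n), ψ (Pi.mulSingle n k) = k := by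
  have hKt (n) : K n ≤ tailSubgroup φ n := (hK n).trans_le inf_le_left
  have hKp (n) : K n ≤ piSubgroup φ (P n) := (hK n).trans_le inf_le_right
  obtain ⟨ψ, hψ, hψs⟩ := exists_hom_of_tail hφ hKt
  refine ⟨ψ, ?_, hψs⟩
  have hKc (n) : IsClosed (K n : Set G) := by
    rw [hK]
    exact (isClosed_tailSubgroup hφ n).inter (isClosed_piSubgroup hφ _)
  have : T2Space G := hφ.isEmbedding.t2Space
  have hcont : Continuous ψ := by
    refine hφ.isInducing.continuous_iff.2 (continuous_pi fun i => ?_)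
    simp only [Function.comp_def, hψ, tailProd_apply]
    exact continuous_finsetProd _ fun k _ => (continuous_apply i).comp
      (hφ.continuous.comp (continuous_subtype_val.comp (continuous_apply k)))
  let R (g : G) (k i : ℕ) : D i := piProj (P k) (hD i) (φ g i)
  have hR : Continuous R := continuous_pi fun k => continuous_pi fun i =>
    continuous_of_discreteTopology.comp ((continuous_apply i).comp hφ.continuous)
  have hRψ : R ∘ ψ = Pi.map fun n (k : K n) => φ k := by
    ext x k i
    change piProj (P k) (hD i) (φ (ψ x) i) = φ (x k) i
    rw [hψ, tailProd_apply, map_prod]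
    have hself := piProj_of_mem (hD i) (mem_piSubgroup.1 (hKp k (x k).2) i)
    by_cases hi : k ≤ i
    · rw [Finset.prod_eq_single k, hself]
      · exact fun j _ hj => piProj_of_mem_of_disjoint (hD i) (hP hj.symm)
          (mem_piSubgroup.1 (hKp j (x j).2) i)
      · exact fun h => absurd (Finset.mem_range.2 (Nat.lt_succ_of_le hi)) h
    · rw [hKt k (x k).2 i (not_le.1 hi)]
      refine Finset.prod_eq_one fun j hj => piProj_of_mem_of_disjoint (hD i) (hP ?_)
        (mem_piSubgroup.1 (hKp j (x j).2) i)
      have := Finset.mem_range.1 hj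
      omega
  have hemb : IsClosedEmbedding (R ∘ ψ) := by
    rw [hRψ]
    exact IsClosedEmbedding.piMap fun n => hφ.comp (hKc n).isClosedEmbedding_subtypeVal
  -- Since `R ∘ ψ` is proper and `G` is Hausdorff, `ψ` is proper, hence has closed range.
  have hprop := isProperMap_of_comp_of_t2 hcont hR hemb.isProperMap
  exact ⟨hemb.isEmbedding.of_comp hcont hR, hprop.isClosedMap.isClosed_range⟩

end Product

theorem exists_closed_noncompact_product {G : Type*} [CommGroup G] [TopologicalSpace G]
    [IsTopologicalGroup G] {D : ℕ → Type} [∀ n, CommGroup (D n)] [∀ n, TopologicalSpace (D n)]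
    [∀ n, DiscreteTopology (D n)] {φ : G →* ∀ n, D n} (hφ : IsClosedEmbedding φ)
    (hD : ∀ n, IsMulTorsion (D n)) (hnlc : ¬ LocallyCompactSpace G)
    (hSylow : ∀ p : ℕ, p.Prime → LocallyCompactSpace (proSylow p G)) :
    ∃ K : ℕ → Subgroup G,
      (∀ n, IsClosed (K n : Set G)) ∧
      (∀ n, ¬ CompactSpace (K n)) ∧
      ∃ φ : (∀ n, K n) →* G,
        IsClosedEmbedding φ ∧ ∀ (n : ℕ) (k : K n), φ (Pi.mulSingle n k) = (k : G) := by
  choose B hB hBP using exists_infinite_primes hφ hD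
    (fun n hn => hnlc (hn.locallyCompactSpace_of_mem_nhds_of_group (tailSubgroup_mem_nhds hφ n)))
    fun p hp => exists_isCompact_inf_of_locallyCompact_proSylow hφ hD hp (hSylow p hp)
  obtain ⟨P, hPB, hP, hdisj⟩ := exists_disjoint_infinite_subsets B hB
  exact ⟨fun n => tailSubgroup φ n ⊓ piSubgroup φ (P n),
    fun n => (isClosed_tailSubgroup hφ n).inter (isClosed_piSubgroup hφ _),
    fun n h => hBP n _ (hPB n) (hP n) (isCompact_iff_compactSpace.2 h),
    exists_isClosedEmbedding_of_disjoint hφ hD hdisj fun _ => rfl⟩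

theorem mainTheorem6 {G : Type*} [CommGroup G] [TopologicalSpace G] [IsTopologicalGroup G]
    [PolishSpace G] (hG : IsQuasiTorsion G) (hnlc : ¬ LocallyCompactSpace G)
    (hSylow : ∀ p : ℕ, p.Prime → LocallyCompactSpace (proSylow p G)) :
    ∃ K : ℕ → Subgroup G,
      (∀ n, IsClosed (K n : Set G)) ∧
      (∀ n, ¬ CompactSpace (K n)) ∧
      ∃ φ : (∀ n, K n) →* G,
        IsClosedEmbedding φ ∧ ∀ (n : ℕ) (k : K n), φ (Pi.mulSingle n k) = (k : G) := by
  obtain ⟨D, _, _, φ, hD, hφ, hsurj⟩ := hG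
  -- Each `D n` is a quotient of the abelian group `G`.
  have hcomm (n : ℕ) (a b : D n) : a * b = b * a := by
    obtain ⟨x, rfl⟩ := hsurj n a
    obtain ⟨y, rfl⟩ := hsurj n b
    simp only [← Pi.mul_apply, ← map_mul, mul_comm]
  let _ (n : ℕ) : CommGroup (D n) := { mul_comm := hcomm n }
  have _ (n : ℕ) : DiscreteTopology (D n) := (hD n).1
  exact exists_closed_noncompact_product hφ (fun n => (hD n).2.2) hnlc hSylow
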